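/- Consider two asynchronous processes that communicate through atomic read/write registers, each performing one $\mathrm{TAS}()$ call. Each process alternates between private coin flips and shared-memory steps (a read or a write of one register), starting with a coin flip, until its call returns a bit; a process whose call has returned only performs no-ops when scheduled. The outcomes of the coin flips (the $i$-th flip among all processes returns $\omega_i$) are i.i.d. from an arbitrary fixed distribution $\mathcal D$ on a countable set $\Omega$. An adversary maps each finite execution to the process taking the next step; it is oblivious if its choice depends only on the length of the execution (counting no-ops), that is, if it fixes the schedule in advance. A randomized 2-process TAS implementation is such an algorithm $M$ all of whose executions, for all schedules and all coin flip outcomes, are linearizable with respect to the test-and-set object (a bit, initially $0$; $\mathrm{TAS}()$ sets the bit and returns its previous value). **Theorem.** For every randomized 2-process TAS implementation $M$ and every integer $t\ge 0$ there is an oblivious adversary $A$ such that, in the random execution of $M$ scheduled by $A$, with probability at least $1/4^t$ the max-step complexity $\max_p T_p$ is at least $t$, where $T_p$ is the number of shared-memory steps that process $p$ takes during its $\mathrm{TAS}()$ call; that is, $$\Pr_{\omega\sim\mathcal D^\infty}\bigl[\text{some process takes at least } t \text{ shared-memory steps}\bigr]\ \ge\ \frac1{4^t}.$$ -/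

import Mathlib

open MeasureTheory
open scoped ENNReal

namespace TwoProcessTAS

/-- An atomic shared-memory access of a process: either a read of register `r`, where `k v` is what
the process does next if the value read is `v`, or a write of `v` to register `r`, where `k` is what
the process does next. -/
inductive Access (Reg Val Next : Type*)
  | read (r : Reg) (k : Val → Next)
  | write (r : Reg) (v : Val) (k : Next)

/-- A randomized one-shot algorithm for two processes (with IDs `0`, `1`), each of which performs a
single `TAS()` call. Coin flips take values in `Ω`, registers are indexed by `Reg` and
hold values in `Val`. Every process alternates between coin flips and shared-memory accesses, and
its first step is a coin flip: `F` is the type of local states in which the next step is a coin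
flip, `O` the type of local states in which it is a shared-memory access.
After any step a process may finish its call, returning a bit (`false` is `0`, `true` is `1`). -/
structure Algorithm (Ω Reg Val F O : Type*) where
  /-- initial contents of the registers -/
  memInit : Reg → Val
  /-- initial local states -/
  start : Fin 2 → F
  /-- what a process does after a coin flip with the given outcome -/
  flip : Fin 2 → F → Ω → O ⊕ Bool
  /-- the shared-memory access that a process performs, and what it does afterwards -/
  access : Fin 2 → O → Access Reg Val (F ⊕ Bool)

/-- The local state of a process. -/
inductive Local (F O : Type*)
  | flipping (f : F)
  | accessing (o : O)
  | finished (b : Bool)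

/-- Local state after a coin flip. -/
def Local.afterFlip {F O : Type*} : O ⊕ Bool → Local F O
  | .inl o => .accessing o
  | .inr b => .finished b

/-- Local state after a shared-memory access. -/
def Local.afterAccess {F O : Type*} : F ⊕ Bool → Local F O
  | .inl f => .flipping f
  | .inr b => .finished b

/-- The return value of the call, once it has finished. -/
def Local.result {F O : Type*} : Local F O → Option Bool
  | .finished b => some b
  | _ => none

/-- What happens in a step. A process that has finished performs only `noop`s. -/
inductive StepKind (Ω Reg Val : Type*)
  | flip (x : Ω)
  | read (r : Reg) (v : Val)
  | write (r : Reg) (v : Val)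
  | noop

/-- Reads and writes are the shared-memory steps. -/
def StepKind.isAccess {Ω Reg Val : Type*} : StepKind Ω Reg Val → Bool
  | .read _ _ => true
  | .write _ _ => true
  | _ => false

/-- One element of an execution: the process taking the step, what happens in the step, and the
response of the process's `TAS()` call if the call finishes with this step. -/
structure Step (Ω Reg Val : Type*) where
  pid : Fin 2
  kind : StepKind Ω Reg Val
  resp : Option Bool

/-- A configuration: register contents, local states, total number of coin flips so far. -/
structure Config (Reg Val F O : Type*) where
  mem : Reg → Val
  loc : Fin 2 → Local F O
  flips : ℕ

section Executions

variable {Ω Reg Val F O : Type*} [DecidableEq Reg]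

/-- The initial configuration. -/
def Algorithm.initConfig (M : Algorithm Ω Reg Val F O) : Config Reg Val F O where
  mem := M.memInit
  loc := fun p => .flipping (M.start p)
  flips := 0

/-- The next step of process `p` in configuration `c`. The outcomes of the coin flips are given by
`ω`: the `i`-th coin flip among all processes (counted from `0`) returns `ω i`. -/
def Algorithm.step (M : Algorithm Ω Reg Val F O) (ω : ℕ → Ω) (c : Config Reg Val F O)
    (p : Fin 2) : Config Reg Val F O × Step Ω Reg Val :=
  match c.loc p with
  | .flipping f =>
      let l : Local F O := .afterFlip (M.flip p f (ω c.flips))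
      (⟨c.mem, Function.update c.loc p l, c.flips + 1⟩, ⟨p, .flip (ω c.flips), l.result⟩)
  | .accessing o =>
      match M.access p o with
      | .read r k =>
          let l : Local F O := .afterAccess (k (c.mem r))
          (⟨c.mem, Function.update c.loc p l, c.flips⟩, ⟨p, .read r (c.mem r), l.result⟩)
      | .write r v k =>
          let l : Local F O := .afterAccess k
          (⟨Function.update c.mem r v, Function.update c.loc p l, c.flips⟩,
            ⟨p, .write r v, l.result⟩)
  | .finished _ => (c, ⟨p, .noop, none⟩)

/-- The execution from configuration `c` in which processes take steps in the order given by a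
finite schedule. -/
def Algorithm.execFrom (M : Algorithm Ω Reg Val F O) (ω : ℕ → Ω) :
    Config Reg Val F O → List (Fin 2) → List (Step Ω Reg Val)
  | _, [] => []
  | c, p :: σ => (M.step ω c p).2 :: M.execFrom ω (M.step ω c p).1 σ

/-- The execution determined by a finite schedule and a coin flip vector. -/
def Algorithm.exec (M : Algorithm Ω Reg Val F O) (σ : List (Fin 2)) (ω : ℕ → Ω) :
    List (Step Ω Reg Val) :=
  M.execFrom ω M.initConfig σ

end Executions

section Linearizability

variable {Ω Reg Val : Type*}

/-- The `TAS()` call of `p` is invoked at position `i`, the position of the first step of `p`. -/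
def InvokedAt (E : List (Step Ω Reg Val)) (p : Fin 2) (i : ℕ) : Prop :=
  (∃ e, E[i]? = some e ∧ e.pid = p) ∧ ∀ j < i, ∀ e, E[j]? = some e → e.pid ≠ p

/-- The `TAS()` call of `p` responds with return value `b` at position `i`. -/
def RespondsAt (E : List (Step Ω Reg Val)) (p : Fin 2) (b : Bool) (i : ℕ) : Prop :=
  ∃ e, E[i]? = some e ∧ e.pid = p ∧ e.resp = some b

/-- The sequential test-and-set object: the calls of the processes in the list are executed
one after the other, starting with stored bit `s`. Each call sets the bit and returns its previous
value; the result lists each call with its return value. -/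
def seqTAS : Bool → List (Fin 2) → List (Fin 2 × Bool)
  | _, [] => []
  | s, p :: l => (p, s) :: seqTAS true l

/-- A finite execution is linearizable with respect to the (one-shot) test-and-set object with
initial bit `0`: there is a sequential order `l` of all completed calls and possibly some pending
ones (the remaining pending calls are dropped), such that every completed call returns
the value it returns in the sequential execution, and the order respects real-time precedence. -/
def Linearizable (E : List (Step Ω Reg Val)) : Prop :=
  ∃ l : List (Fin 2), l.Nodup ∧
    (∀ p ∈ l, ∃ i, InvokedAt E p i) ∧
    (∀ p b i, RespondsAt E p b i → (p, b) ∈ seqTAS false l) ∧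
    (∀ p q b i j, RespondsAt E p b i → InvokedAt E q j → i < j → q ∈ l →
      List.Sublist [p, q] l)

end Linearizability

/-- `M` is an implementation of a 2-process test-and-set object: every execution of `M`, under any
schedule and any coin flip outcomes, is linearizable. -/
def Algorithm.IsTAS {Ω Reg Val F O : Type*} [DecidableEq Reg]
    (M : Algorithm Ω Reg Val F O) : Prop :=
  ∀ (σ : List (Fin 2)) (ω : ℕ → Ω), Linearizable (M.exec σ ω)

/-- An adversary maps a finite execution to the process that takes the next step. -/
abbrev Adversary (Ω Reg Val : Type*) := List (Step Ω Reg Val) → Fin 2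

/-- An oblivious adversary is a function of just the length of the past execution. -/
def Adversary.IsOblivious {Ω Reg Val : Type*} (A : Adversary Ω Reg Val) : Prop :=
  ∀ E E' : List (Step Ω Reg Val), E.length = E'.length → A E = A E'

section Complexity

variable {Ω Reg Val F O : Type*} [DecidableEq Reg]

/-- The first `n` elements of the schedule determined by `M`, `A` and the coin flips. -/
def Algorithm.sched (M : Algorithm Ω Reg Val F O) (A : Adversary Ω Reg Val) (ω : ℕ → Ω) :
    ℕ → List (Fin 2)
  | 0 => []
  | n + 1 => M.sched A ω n ++ [A (M.exec (M.sched A ω n) ω)]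

/-- The number of shared-memory steps that process `p` takes in a finite execution. -/
def accessCount (p : Fin 2) (E : List (Step Ω Reg Val)) : ℕ :=
  E.countP fun e => e.pid = p && e.kind.isAccess

/-- The max-step complexity of the infinite execution of `M` scheduled by `A` with coin flips `ω`:
the maximum over the processes of the (possibly infinite) number of shared-memory steps taken. -/
noncomputable def Algorithm.maxStep (M : Algorithm Ω Reg Val F O) (A : Adversary Ω Reg Val)
    (ω : ℕ → Ω) : ℕ∞ :=
  ⨆ p : Fin 2, ⨆ n : ℕ, (accessCount p (M.exec (M.sched A ω n) ω) : ℕ∞)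

end Complexity

end TwoProcessTAS

namespace TwoProcessTAS

/-! ### Deterministic two-process protocols over read/write registers -/

section Deterministic

variable {Reg Val L : Type*}

/-- Process `p` is the winner in state `s`: it has returned `0`, or the other process has
returned `1`. -/
def Wins (out : L → Option Bool) (p : Fin 2) (s : (Reg → Val) × (Fin 2 → L)) : Prop :=
  ∃ q b, out (s.2 q) = some b ∧ (b = false ↔ q = p)

theorem exists_wins_of_out_eq_some {out : L → Option Bool} {q : Fin 2} {b : Bool} :
    ∃ p, ∀ s : (Reg → Val) × (Fin 2 → L), out (s.2 q) = some b → Wins out p s := by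
  cases b
  · exact ⟨q, fun s h => ⟨q, false, h, by simp⟩⟩
  · exact ⟨1 - q, fun s h => ⟨q, true, h, by clear h; decide +revert⟩⟩

variable [DecidableEq Reg]

/-- One step of process `p` in a deterministic protocol: `act p l` is either a local transition or a
shared-memory access. A global state consists of the register contents and the local states. -/
def detStep (act : Fin 2 → L → L ⊕ Access Reg Val L) (s : (Reg → Val) × (Fin 2 → L)) (p : Fin 2) :
    (Reg → Val) × (Fin 2 → L) :=
  match act p (s.2 p) with
  | .inl l => (s.1, Function.update s.2 p l)
  | .inr (.read r k) => (s.1, Function.update s.2 p (k (s.1 r)))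
  | .inr (.write r v l) => (Function.update s.1 r v, Function.update s.2 p l)

/-- The state reached from `s` under the schedule `σ`. -/
def detRun (act : Fin 2 → L → L ⊕ Access Reg Val L) (s : (Reg → Val) × (Fin 2 → L))
    (σ : List (Fin 2)) : (Reg → Val) × (Fin 2 → L) :=
  σ.foldl (detStep act) s

/-- The registers and the local state of `p` agree in `s` and `s'`, so that `p`, running alone, cannot
distinguish the two states. -/
def Indist (p : Fin 2) (s s' : (Reg → Val) × (Fin 2 → L)) : Prop :=
  s.1 = s'.1 ∧ s.2 p = s'.2 p

variable {act : Fin 2 → L → L ⊕ Access Reg Val L}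

theorem detStep_loc_of_ne {s : (Reg → Val) × (Fin 2 → L)} {p q : Fin 2} (h : q ≠ p) :
    (detStep act s p).2 q = s.2 q := by
  unfold detStep
  split <;> simp [Function.update_of_ne h]

theorem Indist.detStep {p : Fin 2} {s s' : (Reg → Val) × (Fin 2 → L)} (h : Indist p s s') :
    Indist p (detStep act s p) (detStep act s' p) := by
  obtain ⟨hm, hl⟩ := h
  unfold TwoProcessTAS.detStep
  rw [← hl]
  split <;> simp [Indist, hm]

theorem detRun_append (s : (Reg → Val) × (Fin 2 → L)) (σ τ : List (Fin 2)) :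
    detRun act s (σ ++ τ) = detRun act (detRun act s σ) τ := by
  simp [detRun]

theorem Indist.detRun_replicate {p : Fin 2} (n : ℕ) {s s' : (Reg → Val) × (Fin 2 → L)}
    (h : Indist p s s') :
    Indist p (detRun act s (List.replicate n p)) (detRun act s' (List.replicate n p)) := by
  induction n generalizing s s' with
  | zero => exact h
  | succ n ih => exact ih h.detStep

theorem detRun_replicate_loc_of_ne {p q : Fin 2} (h : q ≠ p) (n : ℕ)
    (s : (Reg → Val) × (Fin 2 → L)) : (detRun act s (List.replicate n p)).2 q = s.2 q := by
  induction n generalizing s with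
  | zero => rfl
  | succ n ih => exact (ih _).trans (detStep_loc_of_ne h)

/-- Two steps of different processes commute, or one of them overwrites the other's effect on the
registers. -/
theorem detStep_comm_or_indist (s : (Reg → Val) × (Fin 2 → L)) {p q : Fin 2} (h : p ≠ q) :
    detStep act (detStep act s p) q = detStep act (detStep act s q) p ∨
      Indist q (detStep act s q) (detStep act (detStep act s p) q) ∨
      Indist p (detStep act s p) (detStep act (detStep act s q) p) := by
  have hq : (detStep act s p).2 q = s.2 q := detStep_loc_of_ne h.symm
  have hp : (detStep act s q).2 p = s.2 p := detStep_loc_of_ne h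
  have key : ∀ (s' : (Reg → Val) × (Fin 2 → L)) (u : Fin 2) (l : L), s'.2 u = l →
      detStep act s' u = match act u l with
        | .inl l => (s'.1, Function.update s'.2 u l)
        | .inr (.read r k) => (s'.1, Function.update s'.2 u (k (s'.1 r)))
        | .inr (.write r v l) => (Function.update s'.1 r v, Function.update s'.2 u l) := by
    rintro s' u l rfl; rfl
  rw [key _ _ _ hq, key _ _ _ hp, key s q _ rfl, key s p _ rfl]
  -- A step that writes nothing is invisible to the other process. Of two writes to one register,
  -- the later erases the earlier; writes to different registers commute.
  rcases act p (s.2 p) with l | ⟨r, k⟩ | ⟨r, v, l⟩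
  · right; left; split <;> simp [Indist]
  · right; left; split <;> simp [Indist]
  rcases act q (s.2 q) with l' | ⟨r', k'⟩ | ⟨r', v', l'⟩
  · right; right; simp [Indist]
  · right; right; simp [Indist]
  by_cases hr : r = r'
  · subst hr; right; left; simp [Indist]
  · left; simp [Function.update_comm h, Function.update_comm hr]

/-- Some extension of `s` is won by `p`. -/
def CanWin (act : Fin 2 → L → L ⊕ Access Reg Val L) (out : L → Option Bool) (p : Fin 2)
    (s : (Reg → Val) × (Fin 2 → L)) : Prop :=
  ∃ σ, Wins out p (detRun act s σ)

variable {out : L → Option Bool}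

/-- A deterministic protocol in which solo runs return `0`, and in which two completed calls return
different values, has schedules of every length under which no process returns. -/
theorem exists_schedule_unfinished (s₀ : (Reg → Val) × (Fin 2 → L))
    (hpers : ∀ s p q b, out (s.2 q) = some b → out ((detStep act s p).2 q) = some b)
    (hcons : ∀ σ p q b b', out ((detRun act s₀ σ).2 p) = some b →
      out ((detRun act s₀ σ).2 q) = some b' → (b = b' ↔ p = q))
    (hinit : ∀ p, out (s₀.2 p) = none)
    (hsolo : ∀ p n b, out ((detRun act s₀ (List.replicate n p)).2 p) = some b → b = false)
    (N : ℕ) : ∃ σ : List (Fin 2), σ.length = N ∧ ∀ p, out ((detRun act s₀ σ).2 p) = none := by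
  by_contra! hfin
  have hpers' : ∀ σ s q b, out (s.2 q) = some b → out ((detRun act s σ).2 q) = some b := by
    intro σ
    induction σ with
    | nil => exact fun _ _ _ h => h
    | cons p σ ih => exact fun s q b h => ih _ _ _ (hpers _ _ _ _ h)
  have hend : ∀ σ : List (Fin 2), N ≤ σ.length →
      ∃ p b, out ((detRun act s₀ σ).2 p) = some b := by
    intro σ hσ
    obtain ⟨p, hp⟩ := hfin (σ.take N) (by simpa using hσ)
    obtain ⟨b, hb⟩ := Option.ne_none_iff_exists'.1 hp
    refine ⟨p, b, ?_⟩
    rw [← List.take_append_drop N σ, detRun_append]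
    exact hpers' _ _ _ _ hb
  have huniq : ∀ σ p p', Wins out p (detRun act s₀ σ) → Wins out p' (detRun act s₀ σ) →
      p = p' := by
    rintro σ p p' ⟨q, b, h, hb⟩ ⟨q', b', h', hb'⟩
    have := hcons _ _ _ _ _ h h'
    clear h h' hpers hpers' hcons hinit hsolo hfin hend
    revert b b' p p' q q'
    decide
  have hpersW : ∀ σ s p, Wins out p s → Wins out p (detRun act s σ) :=
    fun σ s p ⟨q, b, h, hb⟩ => ⟨q, b, hpers' _ _ _ _ h, hb⟩
  -- A winner is permanent and unique, so no call has returned in a bivalent state.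
  have hnowin : ∀ σ, CanWin act out 0 (detRun act s₀ σ) → CanWin act out 1 (detRun act s₀ σ) →
      ∀ p, ¬ Wins out p (detRun act s₀ σ) := by
    rintro σ ⟨τ, hτ⟩ ⟨τ', hτ'⟩ p hp
    have h0 := hpersW τ _ _ hp
    have h1 := hpersW τ' _ _ hp
    rw [← detRun_append] at hτ hτ' h0 h1
    exact absurd ((huniq _ _ _ hτ h0).trans (huniq _ _ _ h1 hτ')) (by decide)
  have hbiv : ∀ n, ∃ σ : List (Fin 2), σ.length = n ∧
      CanWin act out 0 (detRun act s₀ σ) ∧ CanWin act out 1 (detRun act s₀ σ) := by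
    intro n
    induction n with
    | zero =>
      -- The initial state is bivalent because either process wins by running alone.
      have : ∀ p, CanWin act out p s₀ := by
        intro p
        obtain ⟨q, b, hq⟩ := hend (List.replicate N p) (by simp)
        have hqp : q = p := by
          by_contra hne
          rw [detRun_replicate_loc_of_ne hne, hinit] at hq
          cases hq
        subst hqp
        exact ⟨_, q, b, hq, by simp [hsolo _ _ _ hq]⟩
      exact ⟨[], rfl, this 0, this 1⟩
    | succ n ih =>
      obtain ⟨σ, hσ, h0, h1⟩ := ih
      -- Otherwise the state is critical: one process's step leaves only winner `0`, the other's
      -- only winner `1`. A winner reachable after both steps refutes this.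
      by_contra! hcrit
      have hno := hnowin σ h0 h1
      have hstep : ∀ r, CanWin act out r (detRun act s₀ σ) →
          ∃ p, CanWin act out r (detRun act s₀ (σ ++ [p])) := by
        rintro r ⟨τ, hτ⟩
        cases τ with
        | nil => exact absurd hτ (hno r)
        | cons p τ => exact ⟨p, τ, by rwa [detRun_append]⟩
      obtain ⟨p, hp⟩ := hstep 0 h0
      obtain ⟨q, hq⟩ := hstep 1 h1
      have hp' := hcrit (σ ++ [p]) (by simp [hσ]) hp
      have hq' : ¬ CanWin act out 0 (detRun act s₀ (σ ++ [q])) :=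
        fun h => hcrit (σ ++ [q]) (by simp [hσ]) h hq
      have hpq : p ≠ q := by rintro rfl; exact hp' hq
      have hdisj : ∀ r, CanWin act out r (detRun act s₀ (σ ++ [p])) →
          ¬ CanWin act out r (detRun act s₀ (σ ++ [q])) := by
        intro r
        fin_cases r
        · exact fun _ => hq'
        · exact fun h => absurd h hp'
      have hnone : ∀ u, out ((detRun act s₀ σ).2 u) = none := by
        intro u
        by_contra hu
        obtain ⟨b, hb⟩ := Option.ne_none_iff_exists'.1 hu
        obtain ⟨r, hr⟩ := exists_wins_of_out_eq_some (Reg := Reg) (Val := Val) (out := out)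
          (q := u) (b := b)
        exact hno r (hr _ hb)
      -- A state that its own mover cannot tell from its successor has a common winner with it.
      have hover : ∀ u v : Fin 2, u ≠ v → Indist v (detStep act (detRun act s₀ σ) v)
          (detStep act (detStep act (detRun act s₀ σ) u) v) →
          ∃ r, CanWin act out r (detRun act s₀ (σ ++ [v])) ∧
            CanWin act out r (detRun act s₀ (σ ++ [u])) := by
        intro u v huv hind
        -- Let `v` run alone: the other process is frozen in an unfinished state, so `v` itself
        -- returns, and with the same bit from both states.
        obtain ⟨w, b, hw⟩ := hend ((σ ++ [v]) ++ List.replicate N v) (by simp; lia)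
        have hwv : w = v := by
          by_contra hne
          rw [detRun_append, detRun_replicate_loc_of_ne hne, detRun_append] at hw
          have : out ((detStep act (detRun act s₀ σ) v).2 w) = some b := hw
          rw [detStep_loc_of_ne hne, hnone] at this
          cases this
        subst hwv
        obtain ⟨r, hr⟩ := exists_wins_of_out_eq_some (Reg := Reg) (Val := Val) (out := out)
          (q := w) (b := b)
        rw [detRun_append, detRun_append] at hw
        refine ⟨r, ⟨List.replicate N w, hr _ ?_⟩, ⟨w :: List.replicate N w, hr _ ?_⟩⟩
        · rwa [detRun_append]
        · rw [detRun_append]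
          exact (congrArg out (hind.detRun_replicate N).2).symm.trans hw
      rcases detStep_comm_or_indist (act := act) (detRun act s₀ σ) hpq with h | h | h
      · obtain ⟨w, b, hw⟩ := hend ((σ ++ [p, q]) ++ List.replicate N p) (by simp; lia)
        obtain ⟨r, hr⟩ := exists_wins_of_out_eq_some (Reg := Reg) (Val := Val) (out := out)
          (q := w) (b := b)
        rw [detRun_append, detRun_append] at hw
        refine hdisj r ⟨q :: List.replicate N p, hr _ ?_⟩ ⟨p :: List.replicate N p, hr _ ?_⟩
        · rwa [detRun_append]
        · have : detRun act s₀ (σ ++ [q]) = detStep act (detRun act s₀ σ) q := by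
            rw [detRun_append]; rfl
          rw [this]
          change out ((detRun act (detStep act (detStep act _ q) p) _).2 w) = _
          rw [← h]
          exact hw
      · obtain ⟨r, hr, hr'⟩ := hover p q hpq h
        exact hdisj r hr' hr
      · obtain ⟨r, hr, hr'⟩ := hover q p hpq.symm h
        exact hdisj r hr hr'
  obtain ⟨σ, hσ, h0, h1⟩ := hbiv N
  obtain ⟨p, b, hb⟩ := hend σ hσ.ge
  obtain ⟨r, hr⟩ := exists_wins_of_out_eq_some (Reg := Reg) (Val := Val) (out := out)
    (q := p) (b := b)
  exact hnowin σ h0 h1 r (hr _ hb)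

end Deterministic

/-! ### Linearizability -/

section Linearizability

variable {Ω Reg Val : Type*}

theorem mem_seqTAS_true {p : Fin 2} {b : Bool} {l : List (Fin 2)} (h : (p, b) ∈ seqTAS true l) :
    b = true ∧ p ∈ l := by
  induction l with
  | nil => cases h
  | cons q l ih =>
    rcases List.mem_cons.1 h with h | h
    · simp_all
    · exact ⟨(ih h).1, List.mem_cons_of_mem _ (ih h).2⟩

/-- The winner is the head of the linearization. Its own call may still be pending, so only its
invocation is guaranteed. -/
theorem exists_winner {E : List (Step Ω Reg Val)} (hE : Linearizable E) {p : Fin 2} {b : Bool}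
    {i : ℕ} (h : RespondsAt E p b i) :
    ∃ x, (∃ j, InvokedAt E x j) ∧ ∀ q b i, RespondsAt E q b i → (b = false ↔ q = x) := by
  obtain ⟨l, hnd, hinv, hresp, -⟩ := hE
  cases l with
  | nil => exact absurd (hresp _ _ _ h) (by simp [seqTAS])
  | cons x l =>
    refine ⟨x, hinv x (by simp), fun q b i hq => ?_⟩
    rcases List.mem_cons.1 (hresp _ _ _ hq) with h | h
    · simp_all
    · obtain ⟨rfl, hm⟩ := mem_seqTAS_true h
      have : q ≠ x := by rintro rfl; exact (List.nodup_cons.1 hnd).1 hm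
      simp [this]

theorem accessCount_append (p : Fin 2) (E E' : List (Step Ω Reg Val)) :
    accessCount p (E ++ E') = accessCount p E + accessCount p E' :=
  List.countP_append

end Linearizability

/-! ### Executions -/

section Runs

variable {Ω Reg Val F O : Type*} [DecidableEq Reg]

namespace Algorithm

variable (M : Algorithm Ω Reg Val F O)

/-- The configuration at the end of the execution with schedule `σ` and coin flips `ω`. -/
def config (ω : ℕ → Ω) (σ : List (Fin 2)) : Config Reg Val F O :=
  σ.foldl (fun c p => (M.step ω c p).1) M.initConfig

theorem config_snoc (ω : ℕ → Ω) (σ : List (Fin 2)) (p : Fin 2) :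
    M.config ω (σ ++ [p]) = (M.step ω (M.config ω σ) p).1 := by
  simp [config]

theorem exec_snoc (ω : ℕ → Ω) (σ : List (Fin 2)) (p : Fin 2) :
    M.exec (σ ++ [p]) ω = M.exec σ ω ++ [(M.step ω (M.config ω σ) p).2] := by
  unfold exec config
  generalize M.initConfig = c
  induction σ generalizing c with
  | nil => rfl
  | cons q σ ih => simp [execFrom, ih]

theorem exec_length (ω : ℕ → Ω) (σ : List (Fin 2)) : (M.exec σ ω).length = σ.length := by
  induction σ using List.reverseRecOn with
  | nil => rfl
  | append_singleton σ p ih => simp [exec_snoc, ih]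

variable {M}

theorem step_pid (ω : ℕ → Ω) (c : Config Reg Val F O) (p : Fin 2) :
    (M.step ω c p).2.pid = p := by
  unfold step
  split
  · rfl
  · split <;> rfl
  · rfl

theorem flips_le_step (ω : ℕ → Ω) (c : Config Reg Val F O) (p : Fin 2) :
    c.flips ≤ (M.step ω c p).1.flips := by
  unfold step
  split
  · simp
  · split <;> simp
  · simp

/-- A step depends only on the coin flips made until its end. -/
theorem step_congr {ω ω' : ℕ → Ω} {c : Config Reg Val F O} {p : Fin 2}
    (h : ∀ i < (M.step ω c p).1.flips, ω i = ω' i) : M.step ω c p = M.step ω' c p := by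
  unfold step at h ⊢
  split
  · simp_all
  · rfl
  · rfl

/-- This permits redefining coins that have not been flipped yet. -/
theorem config_congr {ω ω' : ℕ → Ω} {σ : List (Fin 2)}
    (h : ∀ i < (M.config ω σ).flips, ω i = ω' i) : M.config ω σ = M.config ω' σ := by
  induction σ using List.reverseRecOn with
  | nil => rfl
  | append_singleton σ p ih =>
    rw [config_snoc] at h
    rw [config_snoc, config_snoc,
      ← ih fun i hi => h i (hi.trans_le (flips_le_step _ _ _)), step_congr h]

theorem respondsAt_of_finished {ω : ℕ → Ω} {σ : List (Fin 2)} {p : Fin 2} {b : Bool}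
    (h : (M.config ω σ).loc p = .finished b) : ∃ i, RespondsAt (M.exec σ ω) p b i := by
  induction σ using List.reverseRecOn with
  | nil => cases h
  | append_singleton σ q ih =>
    rw [exec_snoc]
    by_cases hold : (M.config ω σ).loc p = .finished b
    · obtain ⟨i, e, he, hp, hr⟩ := ih hold
      refine ⟨i, e, ?_, hp, hr⟩
      rw [List.getElem?_append_left (List.getElem?_eq_some_iff.1 he).1, he]
    · refine ⟨(M.exec σ ω).length, _, List.getElem?_concat_length, ?_⟩
      rw [config_snoc] at h
      rw [step_pid]
      have hqp : q = p := by
        by_contra hne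
        refine hold ?_
        unfold step at h
        split at h
        · simpa [Function.update_of_ne (Ne.symm hne)] using h
        · split at h <;> simpa [Function.update_of_ne (Ne.symm hne)] using h
        · exact h
      subst hqp
      refine ⟨rfl, ?_⟩
      unfold step at h ⊢
      split at h <;> rename_i heq
      · simp_all [Local.result]
      · split at h <;> simp_all [Local.result]
      · simp_all

theorem pid_mem_of_invokedAt {ω : ℕ → Ω} {σ : List (Fin 2)} {p : Fin 2} {i : ℕ}
    (h : InvokedAt (M.exec σ ω) p i) : p ∈ σ := by
  obtain ⟨⟨e, he, rfl⟩, -⟩ := h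
  have hmem : e ∈ M.exec σ ω := List.mem_of_getElem? he
  clear he i
  induction σ using List.reverseRecOn with
  | nil => cases hmem
  | append_singleton σ q ih =>
    rw [exec_snoc, List.mem_append, List.mem_singleton] at hmem
    rcases hmem with h | rfl
    · exact List.mem_append_left _ (ih h)
    · simp [step_pid]

end Algorithm

theorem Algorithm.IsTAS.result_eq_iff {M : Algorithm Ω Reg Val F O} (hM : M.IsTAS) {ω : ℕ → Ω}
    {σ : List (Fin 2)} {p q : Fin 2} {b b' : Bool} (hp : (M.config ω σ).loc p = .finished b)
    (hq : (M.config ω σ).loc q = .finished b') : b = b' ↔ p = q := by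
  obtain ⟨i, hi⟩ := respondsAt_of_finished hp
  obtain ⟨j, hj⟩ := respondsAt_of_finished hq
  obtain ⟨x, -, hx⟩ := exists_winner (hM σ ω) hi
  have h1 := hx _ _ _ hi
  have h2 := hx _ _ _ hj
  clear hi hj hx hp hq
  decide +revert

/-- The winner must have been invoked, and only `p` was. -/
theorem Algorithm.IsTAS.solo_result {M : Algorithm Ω Reg Val F O} (hM : M.IsTAS) {ω : ℕ → Ω}
    {σ : List (Fin 2)} {p : Fin 2} {b : Bool} (hσ : ∀ q ∈ σ, q = p)
    (hp : (M.config ω σ).loc p = .finished b) : b = false := by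
  obtain ⟨i, hi⟩ := respondsAt_of_finished hp
  obtain ⟨x, ⟨j, hj⟩, hx⟩ := exists_winner (hM σ ω) hi
  exact (hx _ _ _ hi).2 (hσ x (pid_mem_of_invokedAt hj)).symm

end Runs

/-! ### Block schedules

A block of a process consists of a coin flip and the shared-memory access that follows it. -/

section Blocks

variable {Ω Reg Val F O : Type*}

/-- Postcompose the continuation of an access. -/
def Access.map {Next Next' : Type*} (f : Next → Next') : Access Reg Val Next → Access Reg Val Next'
  | .read r k => .read r (f ∘ k)
  | .write r v k => .write r v (f k)

namespace Algorithm

/-- What a block of process `p` with coin flip outcome `x` does. -/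
def blockAct (M : Algorithm Ω Reg Val F O) (x : Ω) (p : Fin 2) :
    F ⊕ Bool → (F ⊕ Bool) ⊕ Access Reg Val (F ⊕ Bool)
  | .inr b => .inl (.inr b)
  | .inl f =>
    match M.flip p f x with
    | .inr b => .inl (.inr b)
    | .inl o => .inr (M.access p o)

/-- Blocks of a process that has its own sequence `a (p, ·)` of coin flip outcomes, and counts its
blocks. -/
def localAct (M : Algorithm Ω Reg Val F O) (a : Fin 2 × ℕ → Ω) (p : Fin 2) (l : (F ⊕ Bool) × ℕ) :
    ((F ⊕ Bool) × ℕ) ⊕ Access Reg Val ((F ⊕ Bool) × ℕ) :=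
  (M.blockAct (a (p, l.2)) p l.1).map (·, l.2 + 1) (Access.map (·, l.2 + 1))

variable [DecidableEq Reg]

/-- The state after `n` blocks, where the `i`-th block is by process `b i`, with coin flip outcome
`x i`. -/
def blockRun (M : Algorithm Ω Reg Val F O) (b : ℕ → Fin 2) (x : ℕ → Ω) :
    ℕ → (Reg → Val) × (Fin 2 → F ⊕ Bool)
  | 0 => (M.memInit, fun p => .inl (M.start p))
  | n + 1 => detStep (M.blockAct (x n)) (M.blockRun b x n) (b n)

variable {M : Algorithm Ω Reg Val F O}

theorem detStep_blockAct_inr {x : Ω} {s : (Reg → Val) × (Fin 2 → F ⊕ Bool)} {q : Fin 2} {b : Bool}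
    (h : s.2 q = .inr b) (p : Fin 2) : (detStep (M.blockAct x) s p).2 q = .inr b := by
  by_cases hqp : q = p
  · subst hqp
    simp [detStep, blockAct, h]
  · rw [detStep_loc_of_ne hqp, h]

theorem detStep_localAct (a : Fin 2 × ℕ → Ω) (m : Reg → Val) (l : Fin 2 → F ⊕ Bool)
    (c : Fin 2 → ℕ) (p : Fin 2) :
    detStep (M.localAct a) (m, fun q => (l q, c q)) p =
      ((detStep (M.blockAct (a (p, c p))) (m, l) p).1,
        fun q => ((detStep (M.blockAct (a (p, c p))) (m, l) p).2 q,
          Function.update c p (c p + 1) q)) := by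
  unfold detStep localAct
  rcases M.blockAct (a (p, c p)) p (l p) with l' | ⟨r, k⟩ | ⟨r, v, l'⟩ <;>
    · simp only [Sum.map_inl, Sum.map_inr, Access.map, Prod.mk.injEq, true_and]
      funext q
      by_cases hq : q = p
      · subst hq; simp
      · simp [Function.update_of_ne hq]

end Algorithm

/-! ### Global and per-process numbering of coin flips -/

/-- The index of the `i`-th coin flip within the coin flips of its own process, when the `j`-th coin
flip is by process `b j`. -/
def flipIndex (b : ℕ → Fin 2) (i : ℕ) : Fin 2 × ℕ :=
  (b i, Nat.count (fun j => b j = b i) i)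

theorem flipIndex_injective (b : ℕ → Fin 2) : Function.Injective (flipIndex b) := by
  intro i j h
  obtain ⟨h1, h2⟩ := Prod.mk.inj h
  rw [← h1] at h2
  exact Nat.count_injective (p := fun k => b k = b i) rfl h1.symm h2

namespace Algorithm

variable [DecidableEq Reg] {M : Algorithm Ω Reg Val F O}

/-- With one coin flip sequence for each process, the block run is a run of a deterministic
protocol. -/
theorem detRun_localAct (a : Fin 2 × ℕ → Ω) (b : ℕ → Fin 2) (n : ℕ) :
    detRun (M.localAct a) (M.memInit, fun p => (.inl (M.start p), 0)) ((List.range n).map b) =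
      ((M.blockRun b (a ∘ flipIndex b) n).1,
        fun p => ((M.blockRun b (a ∘ flipIndex b) n).2 p, Nat.count (fun j => b j = p) n)) := by
  induction n with
  | zero => rfl
  | succ n ih =>
    rw [List.range_succ, List.map_append, detRun_append, ih]
    change detStep _ _ (b n) = _
    rw [detStep_localAct]
    refine Prod.ext rfl (funext fun q => Prod.ext rfl ?_)
    by_cases hq : q = b n
    · subst hq; simp [Nat.count_succ]
    · simp [Nat.count_succ, Function.update_of_ne hq, Ne.symm hq]

/-! ### Block runs as executions -/

/-- The configuration `c` corresponds to the state `s` between two blocks. -/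
def Matches (c : Config Reg Val F O) (s : (Reg → Val) × (Fin 2 → F ⊕ Bool)) : Prop :=
  c.mem = s.1 ∧ ∀ p, c.loc p = .afterAccess (s.2 p)

/-- A process of which a whole block is scheduled performs that block, unless it finishes. -/
theorem Matches.step_step {c : Config Reg Val F O} {s : (Reg → Val) × (Fin 2 → F ⊕ Bool)}
    (h : Matches c s) (ω : ℕ → Ω) {p : Fin 2} {f : F} {o : O} (hf : s.2 p = .inl f)
    (ho : M.flip p f (ω c.flips) = .inl o) :
    Matches (M.step ω (M.step ω c p).1 p).1 (detStep (M.blockAct (ω c.flips)) s p) ∧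
      (M.step ω (M.step ω c p).1 p).1.flips = c.flips + 1 ∧
      (M.step ω (M.step ω c p).1 p).2.kind.isAccess = true := by
  obtain ⟨hm, hl⟩ := h
  have hc : c.loc p = .flipping f := by rw [hl, hf]; rfl
  have h1 : (M.step ω c p).1 =
      ⟨c.mem, Function.update c.loc p (.accessing o), c.flips + 1⟩ := by
    simp [step, hc, ho, Local.afterFlip]
  rw [h1]
  have hloc : ∀ x q, Function.update (Function.update c.loc p (Local.accessing o)) p
      (.afterAccess x) q = .afterAccess (Function.update s.2 p x q) := by
    intro x q
    by_cases hq : q = p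
    · subst hq; simp
    · simp [Function.update_of_ne hq, hl]
  rcases ha : M.access p o with ⟨r, k⟩ | ⟨r, v, l⟩
  · simp [step, ha, Matches, detStep, blockAct, hf, ho, hm, StepKind.isAccess, ← hloc]
  · simp [step, ha, Matches, detStep, blockAct, hf, ho, hm, StepKind.isAccess, ← hloc]

theorem Matches.step_finish {c : Config Reg Val F O} {s : (Reg → Val) × (Fin 2 → F ⊕ Bool)}
    (h : Matches c s) (ω : ℕ → Ω) {p : Fin 2} {f : F} {b : Bool} (hf : s.2 p = .inl f)
    (hb : M.flip p f (ω c.flips) = .inr b) :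
    Matches (M.step ω c p).1 (detStep (M.blockAct (ω c.flips)) s p) := by
  obtain ⟨hm, hl⟩ := h
  have hc : c.loc p = .flipping f := by rw [hl, hf]; rfl
  simp only [step, hc, hb, Matches, detStep, blockAct, hf, hm, true_and]
  intro q
  by_cases hq : q = p
  · subst hq; simp [Local.afterFlip, Local.afterAccess]
  · simp [Function.update_of_ne hq, hl]

/-- Every block run is realised by an execution. -/
theorem exists_config_matches (M : Algorithm Ω Reg Val F O) (b : ℕ → Fin 2) (x : ℕ → Ω) (n : ℕ) :
    ∃ ω σ, (∀ p ∈ σ, ∃ i < n, b i = p) ∧ Matches (M.config ω σ) (M.blockRun b x n) := by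
  induction n with
  | zero => exact ⟨x, [], by simp, rfl, fun p => rfl⟩
  | succ n ih =>
    obtain ⟨ω₀, σ, hσ, hm⟩ := ih
    have hσ' : ∀ p ∈ σ, ∃ i < n + 1, b i = p := fun p hp =>
      let ⟨i, hi, h⟩ := hσ p hp; ⟨i, by lia, h⟩
    -- Blocks of finished processes flip no coin, so the next unused coin may have an index below
    -- `n`. Setting it to `x n` leaves the past unchanged.
    set ω := Function.update ω₀ (M.config ω₀ σ).flips (x n) with hω
    have hcfg : M.config ω₀ σ = M.config ω σ :=
      config_congr fun i hi => by rw [hω, Function.update_of_ne hi.ne]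
    have hx : ω (M.config ω σ).flips = x n := by rw [← hcfg, hω, Function.update_self]
    rw [hcfg] at hm
    rcases hs : (M.blockRun b x n).2 (b n) with f | r
    · rcases hflip : M.flip (b n) f (x n) with o | r
      · refine ⟨ω, σ ++ [b n] ++ [b n], ?_, ?_⟩
        · intro p hp
          simp only [List.append_assoc, List.mem_append, List.mem_cons, List.not_mem_nil,
            or_false, or_self] at hp
          rcases hp with hp | rfl
          exacts [hσ' p hp, ⟨n, by lia, rfl⟩]
        · rw [config_snoc, config_snoc, blockRun, ← hx]
          exact (hm.step_step ω hs (by rw [hx, hflip])).1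
      · refine ⟨ω, σ ++ [b n], ?_, ?_⟩
        · intro p hp
          simp only [List.mem_append, List.mem_cons, List.not_mem_nil, or_false] at hp
          rcases hp with hp | rfl
          exacts [hσ' p hp, ⟨n, by lia, rfl⟩]
        · rw [config_snoc, blockRun, ← hx]
          exact hm.step_finish ω hs (by rw [hx, hflip])
    · refine ⟨ω, σ, hσ', ?_⟩
      have : M.blockRun b x (n + 1) = M.blockRun b x n := by
        have hup : Function.update (M.blockRun b x n).2 (b n) (.inr r) = (M.blockRun b x n).2 := by
          rw [← hs, Function.update_eq_self]
        simp [blockRun, detStep, blockAct, hs, hup]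
      rwa [this]

theorem map_range_getD (σ : List (Fin 2)) :
    (List.range σ.length).map (fun i => σ.getD i 0) = σ := by
  apply List.ext_getElem <;> simp +contextual

/-- For any fixed coin flip sequences of the two processes, there is a block schedule of
length `N` under which no process finishes. -/
theorem IsTAS.exists_blockRun_unfinished (hM : M.IsTAS) (a : Fin 2 × ℕ → Ω) (N : ℕ) :
    ∃ σ : List (Fin 2), σ.length = N ∧ ∀ p,
      ((M.blockRun (fun i => σ.getD i 0) (a ∘ flipIndex fun i => σ.getD i 0) N).2 p).isLeft := by
  let s₀ : (Reg → Val) × (Fin 2 → (F ⊕ Bool) × ℕ) := (M.memInit, fun p => (.inl (M.start p), 0))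
  -- Outcomes of the deterministic protocol occur in genuine executions, so linearizability
  -- constrains them; `τ` uses only processes of `σ`, which keeps solo runs solo.
  have key : ∀ σ : List (Fin 2), ∃ ω τ, (∀ p ∈ τ, p ∈ σ) ∧
      ∀ p b, (detRun (M.localAct a) s₀ σ).2 p |>.1.getRight? = some b →
        (M.config ω τ).loc p = .finished b := by
    intro σ
    obtain ⟨ω, τ, hτ, -, h⟩ := M.exists_config_matches (fun i => σ.getD i 0)
      (a ∘ flipIndex fun i => σ.getD i 0) σ.length
    have hrun := M.detRun_localAct a (fun i => σ.getD i 0) σ.length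
    rw [map_range_getD] at hrun
    refine ⟨ω, τ, ?_, ?_⟩
    · intro p hp
      obtain ⟨i, hi, rfl⟩ := hτ p hp
      simp [hi]
    · intro p b hb
      rw [hrun, Sum.getRight?_eq_some_iff] at hb
      exact (h p).trans (congrArg _ hb)
  have := exists_schedule_unfinished (act := M.localAct a)
    (out := fun l => l.1.getRight?) s₀ ?_ ?_ ?_ ?_ N
  · obtain ⟨σ, hσ, h⟩ := this
    refine ⟨σ, hσ, fun p => ?_⟩
    have hp := h p
    have hrun := M.detRun_localAct a (fun i => σ.getD i 0) σ.length
    rw [map_range_getD] at hrun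
    rw [hrun, hσ] at hp
    simpa using hp
  · rintro ⟨m, l⟩ p q b h
    have := detStep_localAct (M := M) a m (fun q => (l q).1) (fun q => (l q).2) p
    simp only [Prod.mk.eta] at this
    rw [this]
    simp only [Sum.getRight?_eq_some_iff] at h ⊢
    exact detStep_blockAct_inr h p
  · intro σ p q b b' hp hq
    obtain ⟨ω, τ, -, h⟩ := key σ
    exact hM.result_eq_iff (h _ _ hp) (h _ _ hq)
  · exact fun p => rfl
  · intro p n b hp
    obtain ⟨ω, τ, hτ, h⟩ := key (List.replicate n p)
    exact hM.solo_result (fun q hq => List.eq_of_mem_replicate (hτ q hq)) (h _ _ hp)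

/-! ### The oblivious adversary of a block schedule -/

/-- The oblivious adversary that schedules the blocks `b 0`, `b 1`, … -/
def blockAdversary (Ω Reg Val : Type*) (b : ℕ → Fin 2) : Adversary Ω Reg Val :=
  fun E => b (E.length / 2)

theorem sched_blockAdversary_two_mul_succ (b : ℕ → Fin 2) (ω : ℕ → Ω) (n : ℕ) :
    M.sched (blockAdversary Ω Reg Val b) ω (2 * (n + 1)) =
      M.sched (blockAdversary Ω Reg Val b) ω (2 * n) ++ [b n] ++ [b n] := by
  have hlen : ∀ n, (M.sched (blockAdversary Ω Reg Val b) ω n).length = n := by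
    intro n
    induction n with
    | zero => rfl
    | succ n ih => simp [sched, ih]
  have h : ∀ n, M.sched (blockAdversary Ω Reg Val b) ω (n + 1) =
      M.sched (blockAdversary Ω Reg Val b) ω n ++ [b (n / 2)] := by
    intro n
    rw [sched, blockAdversary, exec_length]
    exact congrArg (fun k => _ ++ [b (k / 2)]) (hlen n)
  rw [mul_add, mul_one, h (2 * n + 1), h (2 * n), show 2 * n / 2 = n by lia,
    show (2 * n + 1) / 2 = n by lia]

/-- As long as no process finishes, every block contains a shared-memory step. -/
theorem le_sum_accessCount (b : ℕ → Fin 2) (ω : ℕ → Ω) (n : ℕ)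
    (h : ∀ p, ((M.blockRun b ω n).2 p).isLeft) :
    Matches (M.config ω (M.sched (blockAdversary Ω Reg Val b) ω (2 * n))) (M.blockRun b ω n) ∧
      (M.config ω (M.sched (blockAdversary Ω Reg Val b) ω (2 * n))).flips = n ∧
      n ≤ ∑ p, accessCount p (M.exec (M.sched (blockAdversary Ω Reg Val b) ω (2 * n)) ω) := by
  induction n with
  | zero => exact ⟨⟨rfl, fun p => rfl⟩, rfl, Nat.zero_le _⟩
  | succ n ih =>
    -- Finishing is permanent, so nobody has finished earlier either. Hence each block flips exactly
    -- one coin, and block `n` uses `ω n` itself.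
    have hn : ∀ p, ((M.blockRun b ω n).2 p).isLeft := by
      intro p
      rcases hp : (M.blockRun b ω n).2 p with f | r
      · rfl
      · have := h p
        rw [blockRun, detStep_blockAct_inr hp] at this
        exact this
    obtain ⟨hm, hfl, hsum⟩ := ih hn
    obtain ⟨f, hf⟩ := Sum.isLeft_iff.1 (hn (b n))
    have hflip : ∃ o, M.flip (b n) f (ω n) = .inl o := by
      rcases ho : M.flip (b n) f (ω n) with o | r
      · exact ⟨o, rfl⟩
      · have := h (b n)
        simp [blockRun, detStep, blockAct, hf, ho] at this
    obtain ⟨o, ho⟩ := hflip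
    obtain ⟨h1, h2, h3⟩ := hm.step_step (M := M) ω hf (by rwa [hfl])
    rw [sched_blockAdversary_two_mul_succ, config_snoc, config_snoc, exec_snoc, exec_snoc,
      config_snoc]
    rw [hfl] at h1 h2
    refine ⟨h1, h2, ?_⟩
    simp only [accessCount_append, Finset.sum_add_distrib, add_assoc]
    refine add_le_add hsum (le_add_left ?_)
    refine le_trans ?_ (Finset.single_le_sum (fun _ _ => Nat.zero_le _) (Finset.mem_univ (b n)))
    simp [accessCount, step_pid, h3]

/-- Pigeonhole: `2 * t` blocks contain at least `2 * t` accesses, divided between two processes. -/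
theorem le_maxStep (b : ℕ → Fin 2) (ω : ℕ → Ω) (t : ℕ)
    (h : ∀ p, ((M.blockRun b ω (2 * t)).2 p).isLeft) :
    (t : ℕ∞) ≤ M.maxStep (blockAdversary Ω Reg Val b) ω := by
  obtain ⟨-, -, hs⟩ := le_sum_accessCount b ω (2 * t) h
  obtain ⟨p, hp⟩ : ∃ p, t ≤ accessCount p
      (M.exec (M.sched (blockAdversary Ω Reg Val b) ω (2 * (2 * t))) ω) := by
    by_contra! hlt
    rw [Fin.sum_univ_two] at hs
    have h0 := hlt 0
    have h1 := hlt 1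
    lia
  exact le_iSup_of_le p (le_iSup_of_le (2 * (2 * t)) (by exact_mod_cast hp))

end Algorithm

/-! ### Reindexing i.i.d. families -/

theorem measurable_comp_right {ι κ : Type*} [MeasurableSpace Ω] (g : ι → κ) :
    Measurable fun a : κ → Ω => a ∘ g :=
  measurable_pi_iff.2 fun i => measurable_pi_apply (g i)

/-- Selecting distinct coordinates of an i.i.d. family yields an i.i.d. family. -/
theorem map_comp_infinitePi {ι κ : Type*} [MeasurableSpace Ω] (D : Measure Ω)
    [IsProbabilityMeasure D] {g : ι → κ} (hg : Function.Injective g) :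
    (Measure.infinitePi fun _ : κ => D).map (fun a => a ∘ g) =
      Measure.infinitePi fun _ : ι => D := by
  classical
  refine Measure.eq_infinitePi _ fun s t ht => ?_
  rw [Measure.map_apply (measurable_comp_right g)
    (.pi s.countable_toSet fun i _ => ht i)]
  -- The preimage of a finite box is a finite box over the image indices, with the same factors by
  -- injectivity.
  have hpre : (fun a : κ → Ω => a ∘ g) ⁻¹' Set.pi (↑s) t =
      Set.pi (↑(s.map ⟨g, hg⟩)) (Function.extend g t fun _ => Set.univ) := by
    ext a
    simp [Set.mem_pi, hg.extend_apply]
  rw [hpre, Measure.infinitePi_pi, Finset.prod_map]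
  · simp [hg.extend_apply]
  · intro k hk
    obtain ⟨i, hi, rfl⟩ := Finset.mem_map.1 hk
    simpa [hg.extend_apply] using ht i

end Blocks
end TwoProcessTAS

/-! ### The union bound over block schedules -/

open TwoProcessTAS in
theorem theorem6p1 {Ω Reg Val F O : Type*} [DecidableEq Reg]
    [Countable Ω] [MeasurableSpace Ω] [DiscreteMeasurableSpace Ω]
    (D : Measure Ω) [IsProbabilityMeasure D]
    (M : TwoProcessTAS.Algorithm Ω Reg Val F O) (hM : M.IsTAS) (t : ℕ) :
    ∃ A : TwoProcessTAS.Adversary Ω Reg Val, A.IsOblivious ∧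
      (1 / 4 ^ t : ℝ≥0∞) ≤
        Measure.infinitePi (fun _ : ℕ => D) {ω : ℕ → Ω | (t : ℕ∞) ≤ M.maxStep A ω} := by
  -- The default `0` only extends the schedule to an infinite one; `G` depends on the first `2 * t`
  -- blocks alone.
  let b : List.Vector (Fin 2) (2 * t) → ℕ → Fin 2 := fun σ i => σ.1.getD i 0
  let G : List.Vector (Fin 2) (2 * t) → Set (ℕ → Ω) := fun σ =>
    {ω | ∀ p, ((M.blockRun (b σ) ω (2 * t)).2 p).isLeft}
  have hG : ∀ σ, Measure.infinitePi (fun _ : Fin 2 × ℕ => D)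
      {a | a ∘ flipIndex (b σ) ∈ G σ} ≤ Measure.infinitePi (fun _ : ℕ => D) (G σ) := by
    intro σ
    rw [← map_comp_infinitePi D (flipIndex_injective (b σ))]
    -- This inequality holds for arbitrary sets, so `G σ` need not be shown measurable.
    exact Measure.le_map_apply (measurable_comp_right _).aemeasurable _
  have hcover : (Set.univ : Set (Fin 2 × ℕ → Ω)) ⊆
      ⋃ σ ∈ (Finset.univ : Finset (List.Vector (Fin 2) (2 * t))),
        {a | a ∘ flipIndex (b σ) ∈ G σ} := by
    intro a _
    obtain ⟨σ, hσ, h⟩ := hM.exists_blockRun_unfinished a (2 * t)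
    let v : List.Vector (Fin 2) (2 * t) := ⟨σ, hσ⟩
    exact Set.mem_biUnion (x := v) (Finset.mem_coe.2 (Finset.mem_univ v)) h
  have hsum : ∑ _σ : List.Vector (Fin 2) (2 * t), (1 / 4 ^ t : ℝ≥0∞) ≤
      ∑ σ, Measure.infinitePi (fun _ : ℕ => D) (G σ) := by
    calc ∑ _σ : List.Vector (Fin 2) (2 * t), (1 / 4 ^ t : ℝ≥0∞) = 1 := by
          simp only [Finset.sum_const, Finset.card_univ, card_vector, Fintype.card_fin,
            nsmul_eq_mul, pow_mul]
          norm_num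
          exact ENNReal.mul_inv_cancel (by simp) (by simp)
      _ = Measure.infinitePi (fun _ : Fin 2 × ℕ => D) Set.univ := measure_univ.symm
      _ ≤ _ := measure_mono hcover
      _ ≤ _ := measure_biUnion_finset_le _ _
      _ ≤ _ := Finset.sum_le_sum fun σ _ => hG σ
  obtain ⟨σ, hσ⟩ : ∃ σ, (1 / 4 ^ t : ℝ≥0∞) ≤ Measure.infinitePi (fun _ : ℕ => D) (G σ) := by
    by_contra! hlt
    refine hsum.not_gt (ENNReal.sum_lt_sum_of_nonempty
      ⟨List.Vector.replicate _ 0, Finset.mem_univ _⟩ fun σ _ => hlt σ)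
  refine ⟨Algorithm.blockAdversary Ω Reg Val (b σ), ?_, hσ.trans (measure_mono ?_)⟩
  · intro E E' h
    simp [Algorithm.blockAdversary, h]
  · exact fun ω hω => Algorithm.le_maxStep (b σ) ω t hω
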